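/- Let $T_n h_{n,m}=h_{n+1,m}$ and $T_m h_{n,m}=h_{n,m+1}$ be the shifts of functions on $\mathbb Z^2$. For $\beta\in\mathbb C\setminus\{0\}$ consider the discrete equation for $u:\mathbb Z^2\to\mathbb C$ $$(u_{n,m+1}+1)(u_{n,m}-1)=\beta\,(u_{n+1,m+1}-1)(u_{n+1,m}+1)\qquad(1)$$ and its deformation with parameter $\tau$, which is (1) at $\tau=0$, $$A_n(\tau)(u_{n,m+1}+1)(u_{n,m}-1)=A_{n+1}(\tau)(u_{n+1,m+1}-1)(u_{n+1,m}+1),\qquad A_n(\tau)=(\beta^{-n}+4\tau)^{-1},\qquad(2)$$ where $\tau\in\mathbb C$ is such that $\beta^{-n}+4\tau\ne0$ for all $n\in\mathbb Z$. A conservation law of such an equation is a relation $(T_n-1)p_{n,m}=(T_m-1)q_{n,m}$ that holds on all its solutions. It has order $k\ge1$ if $p_{n,m}$ is a function of $u_{n,m+k_2},\dots,u_{n,m+k_1}$ with $k_1-k_2=k$ and, for all $n,m$, $\partial^2p_{n,m}/\partial u_{n,m+k_1}\partial u_{n,m+k_2}$ is not identically zero. Let $D_{t_1}$ be the derivative along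 $\partial_{t_1}u_{n,m}=A_n(\tau)(u_{n,m}^2-1)(u_{n,m+1}-u_{n,m-1})$, and let $D_\tau$ be the total derivative (the partial derivative in the explicit $\tau$ included) along the master symmetry $$\partial_\tau u_{n,m}=A_n(\tau)(u_{n,m}^2-1)\big((m+1)u_{n,m+1}-(m-1)u_{n,m-1}\big).$$ **Theorem.** There are polynomials $\hat P^{(k)},\hat Q^{(k)},\hat R^{(k)}$ $(k\ge1)$ with complex coefficients that depend on none of $n,m,\tau,\beta$, in $k+1$, $k$ and $k+2$ variables respectively, such that for every $\beta\neq0$ the following hold. (a) For every $k\ge1$, equation (1) has the conservation law $(T_n-1)p^{(k)}_{n,m}=(T_m-1)q^{(k)}_{n,m}$ of order $k$, where $$p^{(k)}_{n,m}=\beta^{nk}\hat P^{(k)}(u_{n,m},\dots,u_{n,m+k}),\qquad q^{(k)}_{n,m}=\beta^{nk}\hat Q^{(k)}(u_{n,m},\dots,u_{n,m+k-1}).$$ (b) These laws are the values at $\tau=0$ of conservation laws of (2), with $$p^{(k)}_{n,m}=A_n(\tau)^k\hat P^{(k)}(u_{n,m},\dots,u_{n,m+k}),\qquad q^{(k)}_{n,m}=A_n(\tau)^k\hat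 Q^{(k)}(u_{n,m},\dots,u_{n,m+k-1}),$$ that are generated by the master symmetry. They start from $p^{(1)}_{n,m}=A_n(\tau)(u_{n,m+1}-1)(u_{n,m}+1)$, $q^{(1)}_{n,m}=-2A_n(\tau)u_{n,m}$. With $r^{(k)}_{n,m}=A_n(\tau)^{k+1}\hat R^{(k)}(u_{n,m-1},\dots,u_{n,m+k})$, for all $k\ge1$, $$D_{t_1}p^{(k)}_{n,m}=(T_m-1)r^{(k)}_{n,m},\qquad p^{(k+1)}_{n,m}=D_\tau p^{(k)}_{n,m}-(T_m-1)\big[(m-1)r^{(k)}_{n,m}\big]$$ identically in $u$, and $$q^{(k+1)}_{n,m}=D_\tau q^{(k)}_{n,m}-(T_n-1)\big[(m-1)r^{(k)}_{n,m}\big]$$ on the solutions of (2). -/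

import Mathlib

/-- A complex field `u_{n,m}` on the square lattice; `u (n, m)` is its value at the site `(n, m)`. -/
abbrev LatticeField : Type := ℤ × ℤ → ℂ

/-- A lattice function `h_{n,m}`: an expression in `n`, `m` and the values of a field `u`. -/
abbrev LatticeFn : Type := ℤ → ℤ → LatticeField → ℂ

/-- The shift `T_n h_{n,m} = h_{n+1,m}`. -/
def shiftN (h : LatticeFn) : LatticeFn := fun n m u => h (n + 1) m u

/-- The shift `T_m h_{n,m} = h_{n,m+1}`. -/
def shiftM (h : LatticeFn) : LatticeFn := fun n m u => h n (m + 1) u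

/-- The partial derivative `∂F/∂u_s` of a function of the field, at the field `u`. -/
noncomputable def partialU (s : ℤ × ℤ) (F : LatticeField → ℂ) (u : LatticeField) : ℂ :=
  deriv (fun z : ℂ => F (Function.update u s z)) (u s)

/-- `u` solves `(u_{n,m+1} + 1)(u_{n,m} - 1) = β (u_{n+1,m+1} - 1)(u_{n+1,m} + 1)` on the lattice. -/
def IsSolution (β : ℂ) (u : LatticeField) : Prop :=
  ∀ n m : ℤ, (u (n, m + 1) + 1) * (u (n, m) - 1) =
    β * ((u (n + 1, m + 1) - 1) * (u (n + 1, m) + 1))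

/-- `(T_n - 1) p = (T_m - 1) q` holds at every site for every field in the solution set `S`. -/
def IsConservationLaw (S : LatticeField → Prop) (p q : LatticeFn) : Prop :=
  ∀ u : LatticeField, S u → ∀ n m : ℤ,
    shiftN p n m u - p n m u = shiftM q n m u - q n m u

/-- The density `p_{n,m}` is a function of `u_{n,m+k₂}, …, u_{n,m+k₁}` with `k₁ > k₂`,
`k₁ - k₂ = k`, and `∂²p_{n,m}/∂u_{n,m+k₁}∂u_{n,m+k₂}` is not identically zero, for all `n, m`. -/
def HasOrder (p : LatticeFn) (k : ℕ) : Prop :=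
  ∃ k₁ k₂ : ℤ, k₂ < k₁ ∧ k₁ - k₂ = (k : ℤ) ∧
    (∀ (n m : ℤ) (u w : LatticeField),
      (∀ j : ℤ, k₂ ≤ j → j ≤ k₁ → u (n, m + j) = w (n, m + j)) → p n m u = p n m w) ∧
    ∀ n m : ℤ, ∃ u : LatticeField,
      partialU (n, m + k₁) (partialU (n, m + k₂) (p n m)) u ≠ 0

/-- The coefficient `A_n(τ) = (β^{-n} + 4τ)⁻¹`. -/
noncomputable def coeffA (β : ℂ) (n : ℤ) (τ : ℂ) : ℂ := (β ^ (-n) + 4 * τ)⁻¹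

/-- The times `τ` at which all coefficients `A_n(τ)` are regular. -/
def IsRegularTime (β τ : ℂ) : Prop := ∀ n : ℤ, β ^ (-n) + 4 * τ ≠ 0

/-- `u` solves `A_n(τ)(u_{n,m+1} + 1)(u_{n,m} - 1) = A_{n+1}(τ)(u_{n+1,m+1} - 1)(u_{n+1,m} + 1)`,
where `τ` is a parameter. -/
def IsSolutionAt (β τ : ℂ) (u : LatticeField) : Prop :=
  ∀ n m : ℤ, coeffA β n τ * ((u (n, m + 1) + 1) * (u (n, m) - 1)) =
    coeffA β (n + 1) τ * ((u (n + 1, m + 1) - 1) * (u (n + 1, m) + 1))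

/-- The symmetry `∂u_{n,m}/∂t₁ = A_n(τ)(u_{n,m}² - 1)(u_{n,m+1} - u_{n,m-1})`. -/
noncomputable def symmF (β τ : ℂ) : LatticeFn := fun n m u =>
  coeffA β n τ * ((u (n, m) ^ 2 - 1) * (u (n, m + 1) - u (n, m - 1)))

/-- The master symmetry
`∂u_{n,m}/∂τ = A_n(τ)(u_{n,m}² - 1)((m + 1)u_{n,m+1} - (m - 1)u_{n,m-1})`. -/
noncomputable def masterG (β τ : ℂ) : LatticeFn := fun n m u =>
  coeffA β n τ * ((u (n, m) ^ 2 - 1) *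
    (((m : ℂ) + 1) * u (n, m + 1) - ((m : ℂ) - 1) * u (n, m - 1)))

/-- The derivative `∑_s V_s ∂h_{n,m}/∂u_s` along `∂u_s = V_s`.
The sum is finite if `h_{n,m}` involves finitely many field values. -/
noncomputable def flowDeriv (V h : LatticeFn) : LatticeFn := fun n m u =>
  ∑ᶠ s : ℤ × ℤ, V s.1 s.2 u * partialU s (h n m) u

/-- The total derivative `D_τ` in virtue of the master symmetry, of a function that depends on `τ`
both explicitly and through the field. -/
noncomputable def totalDerivTau (β : ℂ) (h : ℂ → LatticeFn) (τ : ℂ) : LatticeFn := fun n m u =>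
  deriv (fun t : ℂ => h t n m u) τ + flowDeriv (masterG β τ) (h τ) n m u

/-- The sequence of conservation laws `(p^{(k)}, q^{(k)})`, `k ≥ 1`, of the equation with coefficients
`A_n(τ)` that is generated by the master symmetry. The functions `r^{(k)}` are the fluxes of the
densities `p^{(k)}` along the symmetry `symmF`; they remove the explicit dependence on `m` through
the transformation `p ↦ p + (T_m - 1)h`, `q ↦ q + (T_n - 1)h` with `h = -(m - 1) r^{(k)}`. -/
structure IsMasterHierarchy (β : ℂ) (p q r : ℕ → ℂ → LatticeFn) : Prop where
  start_p : ∀ (τ : ℂ) (n m : ℤ) (u : LatticeField),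
    p 1 τ n m u = coeffA β n τ * ((u (n, m + 1) - 1) * (u (n, m) + 1))
  start_q : ∀ (τ : ℂ) (n m : ℤ) (u : LatticeField),
    q 1 τ n m u = -2 * coeffA β n τ * u (n, m)
  law : ∀ k : ℕ, 1 ≤ k → ∀ τ : ℂ, IsRegularTime β τ →
    IsConservationLaw (IsSolutionAt β τ) (p k τ) (q k τ)
  flux : ∀ k : ℕ, 1 ≤ k → ∀ τ : ℂ, IsRegularTime β τ → ∀ (n m : ℤ) (u : LatticeField),
    flowDeriv (symmF β τ) (p k τ) n m u = shiftM (r k τ) n m u - r k τ n m u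
  step_p : ∀ k : ℕ, 1 ≤ k → ∀ τ : ℂ, IsRegularTime β τ → ∀ (n m : ℤ) (u : LatticeField),
    p (k + 1) τ n m u = totalDerivTau β (p k) τ n m u -
      ((((m + 1 : ℤ) : ℂ) - 1) * shiftM (r k τ) n m u - ((m : ℂ) - 1) * r k τ n m u)
  step_q : ∀ k : ℕ, 1 ≤ k → ∀ τ : ℂ, IsRegularTime β τ →
    ∀ u : LatticeField, IsSolutionAt β τ u → ∀ n m : ℤ,
      q (k + 1) τ n m u = totalDerivTau β (q k) τ n m u -
        (((m : ℂ) - 1) * shiftN (r k τ) n m u - ((m : ℂ) - 1) * r k τ n m u)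

/-- The lattice function `c_n F(u_{n,m+a}, u_{n,m+a+1}, …, u_{n,m+a+l-1})` for a polynomial `F` in
`l` variables: `n` enters explicitly through the multiplier `c_n` only, `m` does not enter. -/
noncomputable def polyFn (c : ℤ → ℂ) (a : ℤ) {l : ℕ} (F : MvPolynomial (Fin l) ℂ) : LatticeFn :=
  fun n m u => c n * MvPolynomial.eval (fun i : Fin l => u (n, m + a + ((i : ℕ) : ℤ))) F

/-! In one row put v_j = (u_{j+1} - 1)(u_j + 1) and w_j = (u_{j+1} + 1)(u_j - 1). The deformed
equation says exactly that A_{n+1} v_{n+1,j} = A_n w_{n,j}, so everything reduces to comparing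
Volterra densities in v and in w within a single row.

Let S_j = 1/(1 - z V_j S_{j+1}). The coefficients of log S_j are Volterra densities: p^(k) is A_n^k
k! [z^k] log S_m for V = v, written as (k-1)! [z^{k-1}] S'/S to avoid logarithms. It is homogeneous
of degree k in V, so on solutions (T_n - 1)p^(k) is A_n^k times the difference of the densities in w
and v. With f_j = 1 - 2z(u_j - 1)S_j(v) one has f_j S_j(w) = S_j(v) f_{j+1}
(`gaugeFactor_mul_stieltjes`). Taking logarithms, that difference is a total m-difference, and q^(k)
comes from log f_m.

Put G_j = V_{j-1}(S_j - 1) and drop the factor A_n from the flows. The first symmetry gives D log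
S_j = G_{j+1} - G_j. The master symmetry gives D log S_j = (1 + 4z) ∂_z log S_j + j G_{j+1} - (j -
1) G_j - V_j, with an analogue for f_j (`mapPowerSeries_stieltjes_master`,
`mapPowerSeries_gaugeFactor_master`). Here ∂_z turns p^(k) into p^(k+1), the G terms are the fluxes
r^(k) with their explicit m, and 4z ∂_z yields 4k p^(k), which cancels against ∂_τ A_n^k = -4k
A_n^{k+1}. Hence the polynomials depend on no parameter.

The order is k because the last V enters the density only through V_m ⋯ V_{m+k-1}
(`voltDensity_top`). -/

section FormalSeries

open PowerSeries

/-- A derivation of the coefficients, extended to power series coefficientwise. -/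
noncomputable def Derivation.mapPowerSeries {A R : Type*} [CommRing A] [CommRing R] [Algebra A R]
    (D : Derivation A R R) : Derivation A R⟦X⟧ R⟦X⟧ where
  toFun F := PowerSeries.mk fun k => D (coeff k F)
  map_add' F G := by ext k; simp
  map_smul' a F := by ext k; simp
  map_one_eq_zero' := by
    ext k
    rcases eq_or_ne k 0 with h | h <;> simp [coeff_one, h]
  leibniz' F G := by
    ext k
    simp only [LinearMap.coe_mk, AddHom.coe_mk, coeff_mk, map_add, smul_eq_mul, coeff_mul, map_sum,
      Derivation.leibniz, Finset.sum_add_distrib]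
    congr 1
    rw [← Finset.Nat.sum_antidiagonal_swap]
    simp

/-! ### Power series: logarithmic derivatives and Stieltjes continued fractions. -/

section Series

variable {A R R' : Type*} [CommRing A] [CommRing R] [CommRing R'] [Algebra A R]

@[simp] theorem coeff_mapPowerSeries (D : Derivation A R R) (F : R⟦X⟧) (k : ℕ) :
    coeff k (D.mapPowerSeries F) = D (coeff k F) := by
  simp [Derivation.mapPowerSeries]

@[simp] theorem mapPowerSeries_C (D : Derivation A R R) (a : R) :
    D.mapPowerSeries (C a) = C (D a) := by
  ext k
  rcases eq_or_ne k 0 with h | h <;> simp [coeff_C, h]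

@[simp] theorem mapPowerSeries_X (D : Derivation A R R) :
    D.mapPowerSeries (X : R⟦X⟧) = 0 := by
  ext k
  rcases eq_or_ne k 1 with h | h <;> simp [coeff_X, h]

theorem mapPowerSeries_derivative (D : Derivation A R R) (F : R⟦X⟧) :
    D.mapPowerSeries (d⁄dX R F) = d⁄dX R (D.mapPowerSeries F) := by
  ext k
  have h : D ((k : R) + 1) = 0 := by
    rw [map_add, D.map_natCast, D.map_one_eq_zero, add_zero]
  simp [coeff_derivative, Derivation.leibniz, h, mul_comm]

/-- The logarithmic derivative `F' / F` of a power series with constant coefficient `1`. -/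
noncomputable def serLogDeriv (F : R⟦X⟧) : R⟦X⟧ := d⁄dX R F * invOfUnit F 1

theorem mul_invOfUnit_one {F : R⟦X⟧} (hF : constantCoeff F = 1) : F * invOfUnit F 1 = 1 :=
  mul_invOfUnit F 1 (by simpa using hF)

theorem mul_serLogDeriv {F : R⟦X⟧} (hF : constantCoeff F = 1) :
    F * serLogDeriv F = d⁄dX R F := by
  unfold serLogDeriv
  linear_combination (d⁄dX R F) * mul_invOfUnit_one hF

theorem cancel_series {F G H : R⟦X⟧} (hF : constantCoeff F = 1) (h : F * G = F * H) : G = H := by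
  linear_combination (invOfUnit F 1) * h - (G - H) * mul_invOfUnit_one hF

theorem serLogDeriv_eq_of_mul {F G H K : R⟦X⟧} (hF : constantCoeff F = 1)
    (hG : constantCoeff G = 1) (hH : constantCoeff H = 1) (hK : constantCoeff K = 1)
    (h : F * G = H * K) :
    serLogDeriv F + serLogDeriv G = serLogDeriv H + serLogDeriv K := by
  have h' := congrArg (d⁄dX R) h
  simp only [Derivation.leibniz, smul_eq_mul, ← mul_serLogDeriv hF, ← mul_serLogDeriv hG,
    ← mul_serLogDeriv hH, ← mul_serLogDeriv hK] at h'
  refine cancel_series hF (cancel_series hG ?_)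
  linear_combination h' - (serLogDeriv H + serLogDeriv K) * h

/-- Along a derivation, `D (log F) = g` implies `D (F' / F) = g'`. -/
theorem mapPowerSeries_serLogDeriv (D : Derivation A R R) {F g : R⟦X⟧}
    (hF : constantCoeff F = 1) (h : D.mapPowerSeries F = F * g) :
    D.mapPowerSeries (serLogDeriv F) = d⁄dX R g := by
  have h1 := congrArg D.mapPowerSeries (mul_serLogDeriv hF)
  rw [mapPowerSeries_derivative, h] at h1
  simp only [Derivation.leibniz, smul_eq_mul, h] at h1
  refine cancel_series hF ?_
  linear_combination h1 - g * mul_serLogDeriv hF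

theorem map_serLogDeriv (φ : R →+* R') {F : R⟦X⟧} (hF : constantCoeff F = 1) :
    PowerSeries.map φ (serLogDeriv F) = serLogDeriv (PowerSeries.map φ F) := by
  have hF' : constantCoeff (PowerSeries.map φ F) = 1 := by
    rw [← coeff_zero_eq_constantCoeff_apply] at hF ⊢
    simp [hF]
  refine cancel_series hF' ?_
  rw [mul_serLogDeriv hF', ← map_mul, mul_serLogDeriv hF]
  ext k
  simp [coeff_derivative]

theorem coeff_serLogDeriv_congr {F G : R⟦X⟧} (hF : constantCoeff F = 1)
    (hG : constantCoeff G = 1) {k : ℕ} (h : ∀ i ≤ k + 1, coeff i F = coeff i G) :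
    coeff k (serLogDeriv F) = coeff k (serLogDeriv G) := by
  have h1 : (X : R⟦X⟧) ^ (k + 1) ∣ F - G :=
    X_pow_dvd_iff.2 fun i hi => by simp [h i (by omega)]
  have h2 : (X : R⟦X⟧) ^ (k + 1) ∣ d⁄dX R F - d⁄dX R G :=
    X_pow_dvd_iff.2 fun i hi => by simp [coeff_derivative, h (i + 1) (by omega)]
  have h3 : serLogDeriv F - serLogDeriv G =
      invOfUnit F 1 * ((d⁄dX R F - d⁄dX R G) - (F - G) * serLogDeriv G) := by
    refine cancel_series hF ?_
    linear_combination mul_serLogDeriv hF - mul_serLogDeriv hG -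
      ((d⁄dX R F - d⁄dX R G) - (F - G) * serLogDeriv G) * mul_invOfUnit_one hF
  have h4 : (X : R⟦X⟧) ^ (k + 1) ∣ serLogDeriv F - serLogDeriv G := by
    rw [h3]
    exact Dvd.dvd.mul_left (dvd_sub h2 (Dvd.dvd.mul_right h1 _)) _
  have := X_pow_dvd_iff.1 h4 k (by omega)
  rw [map_sub] at this
  exact sub_eq_zero.1 this

/-- As F - G is divisible by z^{k+1}, the denominators do not matter at order k, and only F' - G'
contributes. -/
theorem coeff_serLogDeriv_top {F G : R⟦X⟧} (hF : constantCoeff F = 1)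
    (hG : constantCoeff G = 1) {k : ℕ} (h : ∀ i ≤ k, coeff i F = coeff i G) :
    coeff k (serLogDeriv F) - coeff k (serLogDeriv G) =
      (k + 1) * (coeff (k + 1) F - coeff (k + 1) G) := by
  obtain ⟨K, hK⟩ : (X : R⟦X⟧) ^ k ∣ serLogDeriv F - serLogDeriv G := by
    refine X_pow_dvd_iff.2 fun i hi => ?_
    rw [map_sub, coeff_serLogDeriv_congr hF hG fun l hl => h l (by omega), sub_self]
  obtain ⟨H, hH⟩ : (X : R⟦X⟧) ^ (k + 1) ∣ F - G :=
    X_pow_dvd_iff.2 fun i hi => by simp [h i (by omega)]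
  have h1 : X ^ k * (F * K) = d⁄dX R F - d⁄dX R G - X ^ k * (X * (H * serLogDeriv G)) := by
    linear_combination mul_serLogDeriv hF - mul_serLogDeriv hG - F * hK - serLogDeriv G * hH
  have h2 := congrArg (coeff k) h1
  have h3 := congrArg (coeff k) hK
  simp only [map_sub, coeff_X_pow_mul', le_refl, if_true, Nat.sub_self,
    coeff_zero_eq_constantCoeff_apply, map_mul, hF, coeff_derivative, constantCoeff_X] at h2 h3
  rw [h3]
  linear_combination h2

/-- Each use of the recursion gains a factor z, so every power of z divides d. This is the
uniqueness principle behind all identities for continued fractions below. -/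
theorem eq_zero_of_linear_recursion {d a b : ℤ → R⟦X⟧}
    (h : ∀ j, d j = X * (a j * d j + b j * d (j + 1))) (j : ℤ) : d j = 0 := by
  have key : ∀ k : ℕ, ∀ j, (X : R⟦X⟧) ^ k ∣ d j := by
    intro k
    induction k with
    | zero => simp
    | succ k ih =>
      intro j
      rw [h j, pow_succ']
      exact mul_dvd_mul_left _ (dvd_add (Dvd.dvd.mul_left (ih j) _) (Dvd.dvd.mul_left (ih _) _))
  ext k
  simpa using X_pow_dvd_iff.1 (key (k + 1) j) k (by omega)

/-- The coefficients of the Stieltjes continued fraction `1 / (1 - z V_j / (1 - z V_{j+1} / …))`. -/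
noncomputable def stieltjesMoment (V : ℤ → R) : ℕ → ℤ → R
  | 0, _ => 1
  | k + 1, j => V j * ∑ i : Fin (k + 1),
      stieltjesMoment V i j * stieltjesMoment V (k - i) (j + 1)
  termination_by k _ => k
  decreasing_by all_goals omega

theorem stieltjesMoment_zero (V : ℤ → R) (j : ℤ) : stieltjesMoment V 0 j = 1 := by
  rw [stieltjesMoment]

theorem stieltjesMoment_succ (V : ℤ → R) (k : ℕ) (j : ℤ) :
    stieltjesMoment V (k + 1) j = V j * ∑ i ∈ Finset.range (k + 1),
      stieltjesMoment V i j * stieltjesMoment V (k - i) (j + 1) := by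
  rw [stieltjesMoment, Finset.sum_range]

/-- The Stieltjes continued fraction `1 / (1 - z V_j / (1 - z V_{j+1} / …))` as a power series. -/
noncomputable def stieltjes (V : ℤ → R) (j : ℤ) : R⟦X⟧ :=
  PowerSeries.mk fun k => stieltjesMoment V k j

@[simp] theorem constantCoeff_stieltjes (V : ℤ → R) (j : ℤ) :
    constantCoeff (stieltjes V j) = 1 := by
  rw [← coeff_zero_eq_constantCoeff_apply, stieltjes, coeff_mk, stieltjesMoment_zero]

theorem stieltjes_eq (V : ℤ → R) (j : ℤ) :
    stieltjes V j = 1 + X * (C (V j) * (stieltjes V j * stieltjes V (j + 1))) := by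
  ext k
  cases k with
  | zero => simp
  | succ k =>
    rw [map_add, coeff_succ_X_mul, coeff_C_mul, coeff_mul]
    simp [stieltjes, coeff_one, stieltjesMoment_succ,
      Finset.Nat.sum_antidiagonal_eq_sum_range_succ_mk]

theorem stieltjes_unique {V : ℤ → R} {Y : ℤ → R⟦X⟧}
    (h : ∀ j, Y j = 1 + X * (C (V j) * (Y j * Y (j + 1)))) (j : ℤ) : Y j = stieltjes V j := by
  refine sub_eq_zero.1 (eq_zero_of_linear_recursion (d := fun j => Y j - stieltjes V j)
    (a := fun j => C (V j) * Y (j + 1)) (b := fun j => C (V j) * stieltjes V j) (fun j => ?_) j)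
  linear_combination h j - stieltjes_eq V j

theorem map_stieltjes (φ : R →+* R') (V : ℤ → R) (j : ℤ) :
    PowerSeries.map φ (stieltjes V j) = stieltjes (fun i => φ (V i)) j := by
  refine stieltjes_unique (Y := fun j => PowerSeries.map φ (stieltjes V j)) (fun j => ?_) j
  have := congrArg (PowerSeries.map φ) (stieltjes_eq V j)
  simpa using this

theorem add_one_add_natCast (j : ℤ) (l : ℕ) : j + 1 + (l : ℤ) = j + ((l + 1 : ℕ) : ℤ) := by
  push_cast
  ring

theorem stieltjesMoment_congr {V V' : ℤ → R} (k : ℕ) :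
    ∀ j j' : ℤ, (∀ i : ℕ, i < k → V (j + i) = V' (j' + i)) →
      stieltjesMoment V k j = stieltjesMoment V' k j' := by
  induction k using Nat.strong_induction_on with
  | _ k ih =>
    intro j j' h
    cases k with
    | zero => simp [stieltjesMoment_zero]
    | succ k =>
      rw [stieltjesMoment_succ, stieltjesMoment_succ]
      congr 1
      · simpa using h 0 (by omega)
      · refine Finset.sum_congr rfl fun i hi => ?_
        rw [Finset.mem_range] at hi
        rw [ih i (by omega) j j' fun l hl => h l (by omega),
          ih (k - i) (by omega) (j + 1) (j' + 1) fun l hl => by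
            simpa only [add_one_add_natCast] using h (l + 1) (by omega)]

theorem stieltjesMoment_mul (c : R) (V : ℤ → R) (k : ℕ) :
    ∀ j : ℤ, stieltjesMoment (fun i => c * V i) k j = c ^ k * stieltjesMoment V k j := by
  induction k using Nat.strong_induction_on with
  | _ k ih =>
    intro j
    cases k with
    | zero => simp [stieltjesMoment_zero]
    | succ k =>
      rw [stieltjesMoment_succ, stieltjesMoment_succ, Finset.mul_sum, Finset.mul_sum,
        Finset.mul_sum]
      refine Finset.sum_congr rfl fun i hi => ?_
      rw [Finset.mem_range] at hi
      rw [ih i (by omega), ih (k - i) (by omega)]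
      have : c ^ (k + 1) = c * (c ^ i * c ^ (k - i)) := by
        rw [← pow_add, ← pow_succ']
        congr 1
        omega
      rw [this]
      ring

/-- `V_{j+k}` enters the moment of degree `k + 1` only through the product of all variables. -/
theorem stieltjesMoment_top {V V' : ℤ → R} (k : ℕ) :
    ∀ j : ℤ, (∀ i : ℕ, i < k → V (j + i) = V' (j + i)) →
      stieltjesMoment V (k + 1) j - ∏ i ∈ Finset.range (k + 1), V (j + i) =
        stieltjesMoment V' (k + 1) j - ∏ i ∈ Finset.range (k + 1), V' (j + i) := by
  induction k with
  | zero => intro j _; simp [stieltjesMoment_succ, stieltjesMoment_zero]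
  | succ k ih =>
    intro j h
    have h0 : V j = V' j := by simpa using h 0 (by omega)
    have h1 := ih (j + 1) fun i hi => by
      simpa only [add_one_add_natCast] using h (i + 1) (by omega)
    have hp : ∀ U : ℤ → R, ∏ i ∈ Finset.range (k + 1 + 1), U (j + i) =
        U j * ∏ i ∈ Finset.range (k + 1), U (j + 1 + i) := fun U => by
      rw [Finset.prod_range_succ', mul_comm]
      simp [add_one_add_natCast]
    -- Only the term i = 0, where the other factor is the full moment of degree k + 1 at j + 1,
    -- reaches the last variable; the terms with i ≥ 1 agree for V and V'.
    rw [stieltjesMoment_succ, stieltjesMoment_succ, Finset.sum_range_succ' _ (k + 1),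
      Finset.sum_range_succ' _ (k + 1), hp, hp, h0]
    have h2 : ∑ i ∈ Finset.range (k + 1),
        stieltjesMoment V (i + 1) j * stieltjesMoment V (k + 1 - (i + 1)) (j + 1) =
      ∑ i ∈ Finset.range (k + 1),
        stieltjesMoment V' (i + 1) j * stieltjesMoment V' (k + 1 - (i + 1)) (j + 1) := by
      refine Finset.sum_congr rfl fun i hi => ?_
      rw [Finset.mem_range] at hi
      rw [stieltjesMoment_congr (i + 1) j j fun l hl => h l (by omega),
        stieltjesMoment_congr (V := V) (V' := V') (k + 1 - (i + 1)) (j + 1) (j + 1) fun l hl => by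
          simpa only [add_one_add_natCast] using h (l + 1) (by omega)]
    rw [h2]
    simp only [stieltjesMoment_zero, Nat.sub_zero]
    linear_combination V' j * h1

end Series

/-! ### The two Miura maps, the gauge relation, and the flows acting on the continued fractions. -/

section Miura

variable {A R R' : Type*} [CommRing A] [CommRing R] [CommRing R'] [Algebra A R]

/-- The Miura map `(u_{j+1} - 1)(u_j + 1)` from the modified Volterra to the Volterra equation. -/
def miura (u : ℤ → R) (j : ℤ) : R := (u (j + 1) - 1) * (u j + 1)

/-- The second Miura map `(u_{j+1} + 1)(u_j - 1)`. -/
def miuraNeg (u : ℤ → R) (j : ℤ) : R := (u (j + 1) + 1) * (u j - 1)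

/-- The gauge factor that relates the continued fractions of the two Miura maps. -/
noncomputable def gaugeFactor (u : ℤ → R) (j : ℤ) : R⟦X⟧ :=
  1 - X * (C (2 * (u j - 1)) * stieltjes (miura u) j)

@[simp] theorem constantCoeff_gaugeFactor (u : ℤ → R) (j : ℤ) :
    constantCoeff (gaugeFactor u j) = 1 := by
  simp [gaugeFactor]

/-- The series S_j(v) f_{j+1} / f_j satisfies the equation that characterises the continued fraction
of w. -/
theorem gaugeFactor_mul_stieltjes (u : ℤ → R) (j : ℤ) :
    gaugeFactor u j * stieltjes (miuraNeg u) j =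
      stieltjes (miura u) j * gaugeFactor u (j + 1) := by
  have hinv : ∀ i, gaugeFactor u i * invOfUnit (gaugeFactor u i) 1 = 1 := fun i =>
    mul_invOfUnit_one (constantCoeff_gaugeFactor u i)
  have h := stieltjes_unique (V := miuraNeg u) (Y := fun i => stieltjes (miura u) i *
    gaugeFactor u (i + 1) * invOfUnit (gaugeFactor u i) 1) (fun i => ?_) j
  · rw [← h]
    linear_combination stieltjes (miura u) j * gaugeFactor u (j + 1) * hinv j
  · refine cancel_series (constantCoeff_gaugeFactor u i) ?_
    have h0 := stieltjes_eq (miura u) i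
    have h1 := stieltjes_eq (miura u) (i + 1)
    have hf0 : gaugeFactor u i = 1 - X * (C (2 * (u i - 1)) * stieltjes (miura u) i) := rfl
    have hf1 : gaugeFactor u (i + 1) =
      1 - X * (C (2 * (u (i + 1) - 1)) * stieltjes (miura u) (i + 1)) := rfl
    have hf2 : gaugeFactor u (i + 1 + 1) =
      1 - X * (C (2 * (u (i + 1 + 1) - 1)) * stieltjes (miura u) (i + 1 + 1)) := rfl
    have hi0 := hinv i
    have hi1 := hinv (i + 1)
    set S0 := stieltjes (miura u) i
    set S1 := stieltjes (miura u) (i + 1)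
    set S2 := stieltjes (miura u) (i + 1 + 1)
    set f0 := gaugeFactor u i
    set f1 := gaugeFactor u (i + 1)
    set f2 := gaugeFactor u (i + 1 + 1)
    have key : S0 * f1 = f0 + X * (C (miuraNeg u i) * (S0 * S1 * f2)) := by
      rw [hf0, hf1, hf2]
      simp only [miura, miuraNeg, map_mul, map_sub, map_add, map_one, map_ofNat] at h0 h1 ⊢
      linear_combination h0 - 2 * X * (C (u i) - 1) * S0 * h1
    linear_combination key + (S0 * f1 - X * C (miuraNeg u i) * S0 * S1 * f2) * hi0 -
      X * C (miuraNeg u i) * S0 * S1 * f2 * f0 * invOfUnit f0 1 * hi1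

/-- The Volterra flow acts on the continued fraction by a total difference. -/
theorem mapPowerSeries_stieltjes_volterra (D : Derivation A R R) (V : ℤ → R)
    (hV : ∀ j, D (V j) = V j * (V (j + 1) - V (j - 1))) (j : ℤ) :
    D.mapPowerSeries (stieltjes V j) = stieltjes V j *
      (C (V j) * (stieltjes V (j + 1) - 1) - C (V (j - 1)) * (stieltjes V j - 1)) := by
  -- Both sides solve the equation of the continued fraction differentiated along D, so their
  -- difference solves its homogeneous part.
  refine sub_eq_zero.1 (eq_zero_of_linear_recursion
    (d := fun j => D.mapPowerSeries (stieltjes V j) - stieltjes V j *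
      (C (V j) * (stieltjes V (j + 1) - 1) - C (V (j - 1)) * (stieltjes V j - 1)))
    (a := fun j => C (V j) * stieltjes V (j + 1)) (b := fun j => C (V j) * stieltjes V j)
    (fun j => ?_) j)
  have h0 := stieltjes_eq V j
  have h1 := stieltjes_eq V (j + 1)
  have hD := congrArg D.mapPowerSeries h0
  simp only [map_add, Derivation.leibniz, Derivation.map_one_eq_zero, mapPowerSeries_X,
    mapPowerSeries_C, smul_eq_mul, hV, map_mul, map_sub] at hD
  simp only [add_sub_cancel_right]
  set S0 := stieltjes V j
  set S1 := stieltjes V (j + 1)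
  set S2 := stieltjes V (j + 1 + 1)
  linear_combination hD + S0 * C (V (j - 1)) * h0 - S0 * C (V j) * h1

/-- The Volterra master symmetry acts on the continued fraction by the vector field `∂_z`, up to
a total difference. -/
theorem mapPowerSeries_stieltjes_master (D : Derivation A R R) (V : ℤ → R)
    (hV : ∀ j : ℤ, D (V j) = V j * ((j + 2 : ℤ) * V (j + 1) + V j - (j - 1 : ℤ) * V (j - 1) + 4))
    (j : ℤ) :
    D.mapPowerSeries (stieltjes V j) = (1 + 4 * X) * d⁄dX R (stieltjes V j) + stieltjes V j *
      (((j : ℤ) : R⟦X⟧) * (C (V j) * (stieltjes V (j + 1) - 1)) -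
        ((j - 1 : ℤ) : R⟦X⟧) * (C (V (j - 1)) * (stieltjes V j - 1)) - C (V j)) := by
  -- The same linearisation. The part 4z ∂_z reflects the scaling term 4V_j of the flow, since
  -- scaling V amounts to scaling z.
  refine sub_eq_zero.1 (eq_zero_of_linear_recursion
    (d := fun j => D.mapPowerSeries (stieltjes V j) - ((1 + 4 * X) * d⁄dX R (stieltjes V j) +
      stieltjes V j * (((j : ℤ) : R⟦X⟧) * (C (V j) * (stieltjes V (j + 1) - 1)) -
        ((j - 1 : ℤ) : R⟦X⟧) * (C (V (j - 1)) * (stieltjes V j - 1)) - C (V j))))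
    (a := fun j => C (V j) * stieltjes V (j + 1)) (b := fun j => C (V j) * stieltjes V j)
    (fun j => ?_) j)
  have h0 := stieltjes_eq V j
  have h1 := stieltjes_eq V (j + 1)
  have hD := congrArg D.mapPowerSeries h0
  have hd := congrArg (d⁄dX R) h0
  simp only [map_add, Derivation.leibniz, Derivation.map_one_eq_zero, mapPowerSeries_X,
    mapPowerSeries_C, smul_eq_mul, hV, map_mul, map_sub, derivative_X, derivative_C,
    map_intCast, map_ofNat] at hD hd
  simp only [add_sub_cancel_right]
  set S0 := stieltjes V j
  set S1 := stieltjes V (j + 1)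
  set S2 := stieltjes V (j + 1 + 1)
  push_cast at hD ⊢
  linear_combination hD - (1 + 4 * X) * hd + ((j : R⟦X⟧) - 1) * C (V (j - 1)) * S0 * h0 -
    ((j : R⟦X⟧) + 1) * C (V j) * S0 * h1

theorem derivation_miura_volterra (D : Derivation A R R) (u : ℤ → R)
    (hu : ∀ j, D (u j) = (u j ^ 2 - 1) * (u (j + 1) - u (j - 1))) (j : ℤ) :
    D (miura u j) = miura u j * (miura u (j + 1) - miura u (j - 1)) := by
  simp only [miura, Derivation.leibniz, map_sub, map_add, Derivation.map_one_eq_zero, hu,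
    smul_eq_mul, add_sub_cancel_right, sub_add_cancel]
  ring

theorem derivation_miura_master (D : Derivation A R R) (u : ℤ → R)
    (hu : ∀ j : ℤ, D (u j) = (u j ^ 2 - 1) * ((j + 1 : ℤ) * u (j + 1) - (j - 1 : ℤ) * u (j - 1)))
    (j : ℤ) :
    D (miura u j) = miura u j * ((j + 2 : ℤ) * miura u (j + 1) + miura u j -
      (j - 1 : ℤ) * miura u (j - 1) + 4) := by
  simp only [miura, Derivation.leibniz, map_sub, map_add, Derivation.map_one_eq_zero, hu,
    smul_eq_mul, add_sub_cancel_right, sub_add_cancel]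
  push_cast
  ring

/-- The bracket is the difference of the flux generating functions for w and v; it becomes the
n-difference of r in the recursion for q. Once D S_j is known, only the equation of S_j and the
gauge relation are needed. -/
theorem mapPowerSeries_gaugeFactor_master (D : Derivation A R R) (u : ℤ → R)
    (hu : ∀ j : ℤ, D (u j) = (u j ^ 2 - 1) * ((j + 1 : ℤ) * u (j + 1) - (j - 1 : ℤ) * u (j - 1)))
    (j : ℤ) :
    D.mapPowerSeries (gaugeFactor u j) = (1 + 4 * X) * d⁄dX R (gaugeFactor u j) +
      gaugeFactor u j * (C (2 * (u j - 1)) + ((j - 1 : ℤ) : R⟦X⟧) *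
        (C (miuraNeg u (j - 1)) * (stieltjes (miuraNeg u) j - 1) -
          C (miura u (j - 1)) * (stieltjes (miura u) j - 1))) := by
  have hS := mapPowerSeries_stieltjes_master D (miura u) (derivation_miura_master D u hu) j
  have h0 := stieltjes_eq (miura u) j
  have hf := gaugeFactor_mul_stieltjes u j
  have hf0 : gaugeFactor u j = 1 - X * (C (2 * (u j - 1)) * stieltjes (miura u) j) := rfl
  have hf1 : gaugeFactor u (j + 1) =
    1 - X * (C (2 * (u (j + 1) - 1)) * stieltjes (miura u) (j + 1)) := rfl
  have hDf := congrArg D.mapPowerSeries hf0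
  have hdf := congrArg (d⁄dX R) hf0
  have h2 : D 2 = 0 := by simpa using D.map_natCast 2
  simp only [map_sub, Derivation.leibniz, Derivation.map_one_eq_zero, mapPowerSeries_X,
    mapPowerSeries_C, smul_eq_mul, hu, hS, h2, map_mul, derivative_X, derivative_C] at hDf hdf
  rw [hDf, hdf]
  set S0 := stieltjes (miura u) j
  set S1 := stieltjes (miura u) (j + 1)
  set Sw := stieltjes (miuraNeg u) j
  set dS := d⁄dX R S0
  simp only [miura, miuraNeg, map_mul, map_sub, map_add, map_one, map_pow, map_ofNat, map_intCast,
    map_zero, sub_add_cancel] at h0 hf hf0 hf1 ⊢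
  push_cast
  linear_combination -(((j : R⟦X⟧) - 1) * (C (u j) + 1) * (C (u (j - 1)) - 1)) * (hf + S0 * hf1) -
    (2 * (C (u j) - 1) - ((j : R⟦X⟧) - 1) * ((C (u j) + 1) * (C (u (j - 1)) - 1) +
      (C (u j) - 1) * (C (u (j - 1)) + 1) * (S0 - 1))) * hf0 +
    2 * ((j : R⟦X⟧) * C (u j) - 1 - ((j : R⟦X⟧) - 1) * C (u (j - 1))) * h0

end Miura

/-! ### Densities and fluxes as coefficients: recursion, homogeneity, locality. -/

section Densities

open scoped Nat

variable {A R R' : Type*} [CommRing A] [CommRing R] [CommRing R'] [Algebra A R]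

/-- The conserved density of degree `k ≥ 1` of the Volterra equation, anchored at the site `j`. -/
noncomputable def voltDensity (V : ℤ → R) (k : ℕ) (j : ℤ) : R :=
  ((k - 1)! : R) * coeff (k - 1) (serLogDeriv (stieltjes V j))

/-- The flux of the density `voltDensity` along the Volterra flow. -/
noncomputable def voltFlux (V : ℤ → R) (k : ℕ) (j : ℤ) : R :=
  (k ! : R) * (V (j - 1) * stieltjesMoment V k j)

/-- The difference of the densities of the two Miura maps is the total difference of this function
of the modified field. -/
noncomputable def gaugeDensity (u : ℤ → R) (k : ℕ) (j : ℤ) : R :=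
  ((k - 1)! : R) * coeff (k - 1)
    (serLogDeriv (gaugeFactor u j) - 2 * invOfUnit (1 + 4 * X) 1)

theorem coeff_stieltjes (V : ℤ → R) (k : ℕ) (j : ℤ) :
    coeff k (stieltjes V j) = stieltjesMoment V k j := by
  rw [stieltjes, coeff_mk]

theorem voltDensity_one (V : ℤ → R) (j : ℤ) : voltDensity V 1 j = V j := by
  simp [voltDensity, serLogDeriv, ← coeff_zero_eq_constantCoeff_apply (d⁄dX R _),
    coeff_derivative, coeff_stieltjes, stieltjesMoment_succ, stieltjesMoment_zero]

theorem coeff_one_gaugeFactor (u : ℤ → R) (j : ℤ) (k : ℕ) :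
    coeff (k + 1) (gaugeFactor u j) = -(2 * (u j - 1) * stieltjesMoment (miura u) k j) := by
  rw [gaugeFactor, map_sub, coeff_succ_X_mul, coeff_C_mul, coeff_stieltjes]
  simp [coeff_one]

/-- The logarithmic derivative of f_j alone starts with -2u_j + 2. Subtracting 2/(1 + 4z) removes
the 2 without disturbing the recursion, because (1 + 4z) times it is constant. -/
theorem gaugeDensity_one (u : ℤ → R) (j : ℤ) : gaugeDensity u 1 j = -2 * u j := by
  have h : constantCoeff (2 : R⟦X⟧) = 2 := map_ofNat _ 2
  simp [gaugeDensity, serLogDeriv, ← coeff_zero_eq_constantCoeff_apply (d⁄dX R _),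
    coeff_derivative, coeff_one_gaugeFactor, stieltjesMoment_zero, h]
  ring

theorem derivation_natCast_mul (D : Derivation A R R) (k : ℕ) (a : R) :
    D ((k : R) * a) = (k : R) * D a := by
  rw [Derivation.leibniz, D.map_natCast, smul_zero, add_zero, smul_eq_mul]

theorem derivation_voltDensity_volterra (D : Derivation A R R) (V : ℤ → R)
    (hV : ∀ j, D (V j) = V j * (V (j + 1) - V (j - 1))) {k : ℕ} (hk : 1 ≤ k) (j : ℤ) :
    D (voltDensity V k j) = voltFlux V k (j + 1) - voltFlux V k j := by
  obtain ⟨k, rfl⟩ := Nat.exists_eq_add_of_le' hk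
  have h := congrArg (coeff k) (mapPowerSeries_serLogDeriv D (constantCoeff_stieltjes V j)
    (mapPowerSeries_stieltjes_volterra D V hV j))
  rw [coeff_mapPowerSeries] at h
  rw [voltDensity, derivation_natCast_mul, Nat.add_sub_cancel, h]
  simp only [voltFlux, coeff_derivative, map_sub, coeff_C_mul, coeff_stieltjes, coeff_one,
    Nat.succ_ne_zero, if_false, Nat.factorial_succ, add_sub_cancel_right]
  push_cast
  ring

/-- The derivative in z kills the stray term -V_j, and the weight (k-1)! makes the coefficient of
the next density equal to 1. -/
theorem derivation_voltDensity_master (D : Derivation A R R) (V : ℤ → R)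
    (hV : ∀ j : ℤ, D (V j) = V j * ((j + 2 : ℤ) * V (j + 1) + V j - (j - 1 : ℤ) * V (j - 1) + 4))
    {k : ℕ} (hk : 1 ≤ k) (j : ℤ) :
    D (voltDensity V k j) = voltDensity V (k + 1) j + 4 * k * voltDensity V k j +
      (j * voltFlux V k (j + 1) - (j - 1) * voltFlux V k j) := by
  obtain ⟨k, rfl⟩ := Nat.exists_eq_add_of_le' hk
  have h := congrArg (coeff k) (mapPowerSeries_serLogDeriv D (constantCoeff_stieltjes V j)
    (g := (1 + 4 * X) * serLogDeriv (stieltjes V j) +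
      (((j : ℤ) : R⟦X⟧) * (C (V j) * (stieltjes V (j + 1) - 1)) -
        ((j - 1 : ℤ) : R⟦X⟧) * (C (V (j - 1)) * (stieltjes V j - 1)) - C (V j))) (by
      rw [mapPowerSeries_stieltjes_master D V hV j,
        ← mul_serLogDeriv (constantCoeff_stieltjes V j)]
      ring))
  have h4 : (1 + 4 * X) * serLogDeriv (stieltjes V j) =
      serLogDeriv (stieltjes V j) + X * (C 4 * serLogDeriv (stieltjes V j)) := by
    rw [map_ofNat]
    ring
  rw [coeff_mapPowerSeries, h4, ← map_intCast (C : R →+* R⟦X⟧), ← map_intCast (C : R →+* R⟦X⟧)] at h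
  rw [voltDensity, derivation_natCast_mul, Nat.add_sub_cancel, h]
  simp only [voltFlux, voltDensity, coeff_derivative, map_sub, map_add, coeff_C_mul,
    coeff_stieltjes, coeff_one, coeff_succ_X_mul, coeff_C, Nat.add_sub_cancel,
    Nat.succ_ne_zero, if_false, Nat.factorial_succ, add_sub_cancel_right]
  push_cast
  ring

theorem derivation_gaugeDensity_master (D : Derivation A R R) (u : ℤ → R)
    (hu : ∀ j : ℤ, D (u j) = (u j ^ 2 - 1) * ((j + 1 : ℤ) * u (j + 1) - (j - 1 : ℤ) * u (j - 1)))
    {k : ℕ} (hk : 1 ≤ k) (j : ℤ) :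
    D (gaugeDensity u k j) = gaugeDensity u (k + 1) j + 4 * k * gaugeDensity u k j +
      (j - 1) * (voltFlux (miuraNeg u) k j - voltFlux (miura u) k j) := by
  obtain ⟨k, rfl⟩ := Nat.exists_eq_add_of_le' hk
  have hN : (1 + 4 * X : R⟦X⟧) * invOfUnit (1 + 4 * X) 1 = 1 := mul_invOfUnit_one (by simp)
  have hDN : D.mapPowerSeries (2 * invOfUnit (1 + 4 * X) 1) = 0 := by
    have h2 : D.mapPowerSeries 2 = 0 := by simpa using D.mapPowerSeries.map_natCast 2
    have h4 : D.mapPowerSeries 4 = 0 := by simpa using D.mapPowerSeries.map_natCast 4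
    have := congrArg D.mapPowerSeries hN
    simp only [Derivation.leibniz, map_add, Derivation.map_one_eq_zero, h4, mapPowerSeries_X,
      smul_eq_mul] at this
    rw [Derivation.leibniz, h2, smul_zero, add_zero, smul_eq_mul]
    rw [cancel_series (F := 1 + 4 * X) (G := D.mapPowerSeries (invOfUnit (1 + 4 * X) 1)) (H := 0)
      (by simp) (by linear_combination this), mul_zero]
  have h := mapPowerSeries_serLogDeriv D (constantCoeff_gaugeFactor u j)
    (g := (1 + 4 * X) * serLogDeriv (gaugeFactor u j) +
      (C (2 * (u j - 1)) + ((j - 1 : ℤ) : R⟦X⟧) *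
        (C (miuraNeg u (j - 1)) * (stieltjes (miuraNeg u) j - 1) -
          C (miura u (j - 1)) * (stieltjes (miura u) j - 1)))) (by
      rw [mapPowerSeries_gaugeFactor_master D u hu j,
        ← mul_serLogDeriv (constantCoeff_gaugeFactor u j)]
      ring)
  rw [← sub_zero (D.mapPowerSeries _), ← hDN, ← map_sub] at h
  set L := serLogDeriv (gaugeFactor u j) - 2 * invOfUnit (1 + 4 * X) 1 with hL
  have h4 : (1 + 4 * X) * serLogDeriv (gaugeFactor u j) = L + X * (C 4 * L) + C 2 := by
    rw [map_ofNat, map_ofNat, hL]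
    linear_combination 2 * hN
  replace h := congrArg (coeff k) h
  rw [coeff_mapPowerSeries, h4, ← map_intCast (C : R →+* R⟦X⟧)] at h
  rw [gaugeDensity, derivation_natCast_mul, Nat.add_sub_cancel, ← hL, h]
  simp only [voltFlux, gaugeDensity, coeff_derivative, map_sub, map_add, coeff_C_mul,
    coeff_stieltjes, coeff_one, coeff_succ_X_mul, coeff_C, Nat.add_sub_cancel, ← hL,
    Nat.succ_ne_zero, if_false, Nat.factorial_succ]
  push_cast
  ring

theorem voltDensity_miuraNeg_sub (u : ℤ → R) (k : ℕ) (j : ℤ) :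
    voltDensity (miuraNeg u) k j - voltDensity (miura u) k j =
      gaugeDensity u k (j + 1) - gaugeDensity u k j := by
  have h := congrArg (coeff (k - 1)) (serLogDeriv_eq_of_mul (constantCoeff_gaugeFactor u j)
    (constantCoeff_stieltjes _ j) (constantCoeff_stieltjes _ j)
    (constantCoeff_gaugeFactor u (j + 1)) (gaugeFactor_mul_stieltjes u j))
  simp only [map_add] at h
  simp only [voltDensity, gaugeDensity, map_sub]
  linear_combination ((k - 1)! : R) * h

theorem voltFlux_mul (c : R) (V : ℤ → R) (k : ℕ) (j : ℤ) :
    voltFlux (fun i => c * V i) k j = c ^ (k + 1) * voltFlux V k j := by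
  rw [voltFlux, voltFlux, stieltjesMoment_mul]
  ring

/-- Scaling V by c replaces z by cz in the continued fraction. -/
theorem voltDensity_mul (c : R) (V : ℤ → R) {k : ℕ} (hk : 1 ≤ k) (j : ℤ) :
    voltDensity (fun i => c * V i) k j = c ^ k * voltDensity V k j := by
  obtain ⟨k, rfl⟩ := Nat.exists_eq_add_of_le' hk
  have h1 : stieltjes (fun i => c * V i) j = rescale c (stieltjes V j) := by
    ext i
    rw [coeff_rescale, coeff_stieltjes, coeff_stieltjes, stieltjesMoment_mul]
  have h2 : serLogDeriv (stieltjes (fun i => c * V i) j) =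
      C c * rescale c (serLogDeriv (stieltjes V j)) := by
    refine cancel_series (constantCoeff_stieltjes (fun i => c * V i) j) ?_
    rw [mul_serLogDeriv (constantCoeff_stieltjes _ j), h1, mul_left_comm, ← map_mul,
      mul_serLogDeriv (constantCoeff_stieltjes _ j)]
    ext i
    simp only [coeff_derivative, coeff_C_mul, coeff_rescale]
    ring
  rw [voltDensity, voltDensity, h2, coeff_C_mul, coeff_rescale, Nat.add_sub_cancel]
  ring

theorem map_stieltjesMoment (ψ : R →+* R') (V : ℤ → R) (k : ℕ) (j : ℤ) :
    ψ (stieltjesMoment V k j) = stieltjesMoment (fun i => ψ (V i)) k j := by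
  rw [← coeff_stieltjes, ← coeff_stieltjes, ← map_stieltjes, coeff_map]

theorem map_voltDensity (ψ : R →+* R') (V : ℤ → R) (k : ℕ) (j : ℤ) :
    ψ (voltDensity V k j) = voltDensity (fun i => ψ (V i)) k j := by
  rw [voltDensity, voltDensity, ← map_stieltjes,
    ← map_serLogDeriv ψ (constantCoeff_stieltjes V j), coeff_map, map_mul, map_natCast]

theorem map_voltFlux (ψ : R →+* R') (V : ℤ → R) (k : ℕ) (j : ℤ) :
    ψ (voltFlux V k j) = voltFlux (fun i => ψ (V i)) k j := by
  rw [voltFlux, voltFlux, map_mul, map_mul, map_natCast, map_stieltjesMoment]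

theorem map_miura (ψ : R →+* R') (u : ℤ → R) :
    (fun i => ψ (miura u i)) = miura fun i => ψ (u i) := by
  ext i
  simp [miura]

theorem map_gaugeDensity (ψ : R →+* R') (u : ℤ → R) (k : ℕ) (j : ℤ) :
    ψ (gaugeDensity u k j) = gaugeDensity (fun i => ψ (u i)) k j := by
  have hf : PowerSeries.map ψ (gaugeFactor u j) = gaugeFactor (fun i => ψ (u i)) j := by
    simp [gaugeFactor, map_stieltjes, map_miura, map_ofNat ψ 2]
  have hN : PowerSeries.map ψ (invOfUnit (1 + 4 * X) 1) = invOfUnit (1 + 4 * X) 1 := by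
    refine cancel_series (F := 1 + 4 * X) (by simp) ?_
    rw [mul_invOfUnit_one (by simp)]
    have := congrArg (PowerSeries.map ψ)
      (mul_invOfUnit_one (F := (1 + 4 * X : R⟦X⟧)) (by simp))
    rwa [map_mul, map_add, map_mul, map_one, map_ofNat, map_X] at this
  have h := congrArg (coeff (k - 1)) (map_serLogDeriv ψ (constantCoeff_gaugeFactor u j))
  rw [hf, coeff_map] at h
  have h2 : (2 : R⟦X⟧) = C 2 := (map_ofNat C 2).symm
  have h2' : (2 : R'⟦X⟧) = C 2 := (map_ofNat C 2).symm
  rw [gaugeDensity, gaugeDensity, map_mul, map_natCast, map_sub, map_sub, map_sub, h, h2, h2',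
    coeff_C_mul, coeff_C_mul, map_mul, map_ofNat, ← coeff_map, hN]

theorem voltDensity_congr {V V' : ℤ → R} {k : ℕ} (hk : 1 ≤ k) {j j' : ℤ}
    (h : ∀ i : ℕ, i < k → V (j + i) = V' (j' + i)) :
    voltDensity V k j = voltDensity V' k j' := by
  rw [voltDensity, voltDensity, coeff_serLogDeriv_congr (constantCoeff_stieltjes V j)
    (constantCoeff_stieltjes V' j')]
  intro i hi
  rw [coeff_stieltjes, coeff_stieltjes]
  exact stieltjesMoment_congr i j j' fun l hl => h l (by omega)

theorem miura_congr {u u' : ℤ → R} {k : ℕ} {j j' : ℤ}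
    (h : ∀ i : ℕ, i < k + 1 → u (j + i) = u' (j' + i)) (i : ℕ) (hi : i < k) :
    miura u (j + i) = miura u' (j' + i) := by
  have h1 := h (i + 1) (by omega)
  rw [← add_one_add_natCast, ← add_one_add_natCast, add_right_comm, add_right_comm j'] at h1
  rw [miura, miura, h i (by omega), h1]

theorem voltFlux_miura_congr {u u' : ℤ → R} {k : ℕ} {j j' : ℤ}
    (h : ∀ i : ℕ, i < k + 2 → u (j - 1 + i) = u' (j' - 1 + i)) :
    voltFlux (miura u) k j = voltFlux (miura u') k j' := by
  have h1 := miura_congr h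
  rw [voltFlux, voltFlux, stieltjesMoment_congr (V' := miura u') k j j']
  · have := h1 0 (by omega)
    simp only [Nat.cast_zero, add_zero] at this
    rw [this]
  · intro i hi
    have := h1 (i + 1) (by omega)
    rwa [← add_one_add_natCast, ← add_one_add_natCast, sub_add_cancel, sub_add_cancel] at this

theorem gaugeDensity_congr {u u' : ℤ → R} {k : ℕ} (hk : 1 ≤ k) {j j' : ℤ}
    (h : ∀ i : ℕ, i < k → u (j + i) = u' (j' + i)) :
    gaugeDensity u k j = gaugeDensity u' k j' := by
  rw [gaugeDensity, gaugeDensity, map_sub, map_sub,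
    coeff_serLogDeriv_congr (constantCoeff_gaugeFactor u j) (constantCoeff_gaugeFactor u' j')]
  intro i hi
  cases i with
  | zero => simp
  | succ i =>
    have h0 : u j = u' j' := by simpa using h 0 (by omega)
    rw [coeff_one_gaugeFactor, coeff_one_gaugeFactor, h0, stieltjesMoment_congr i j j'
      (miura_congr fun l hl => h l (by omega))]

/-- Meant for D = ∂/∂u_s, after u_s has been frozen to a constant in V. -/
theorem derivation_voltDensity_eq_zero (D : Derivation A R R) (V : ℤ → R) (hV : ∀ j, D (V j) = 0)
    {k : ℕ} (j : ℤ) : D (voltDensity V k j) = 0 := by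
  have h : ∀ j, D.mapPowerSeries (stieltjes V j) = 0 := fun j => by
    refine eq_zero_of_linear_recursion (d := fun j => D.mapPowerSeries (stieltjes V j))
      (a := fun j => C (V j) * stieltjes V (j + 1)) (b := fun j => C (V j) * stieltjes V j)
      (fun j => ?_) j
    have hD := congrArg D.mapPowerSeries (stieltjes_eq V j)
    simp only [map_add, Derivation.leibniz, Derivation.map_one_eq_zero, mapPowerSeries_X,
      mapPowerSeries_C, smul_eq_mul, hV, map_zero] at hD
    linear_combination hD
  have h1 := congrArg (coeff (k - 1)) (mapPowerSeries_serLogDeriv D (g := 0)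
    (constantCoeff_stieltjes V j) (by rw [h, mul_zero]))
  rw [coeff_mapPowerSeries, map_zero, map_zero] at h1
  rw [voltDensity, derivation_natCast_mul, h1, mul_zero]

/-- The last variable enters the density of degree `k` only through the product of all variables. -/
theorem voltDensity_top {V V' : ℤ → R} (k : ℕ) (j : ℤ)
    (h : ∀ i : ℕ, i < k → V (j + i) = V' (j + i)) :
    voltDensity V (k + 1) j - ((k + 1)! : R) * ∏ i ∈ Finset.range (k + 1), V (j + i) =
      voltDensity V' (k + 1) j - ((k + 1)! : R) * ∏ i ∈ Finset.range (k + 1), V' (j + i) := by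
  have h1 := coeff_serLogDeriv_top (constantCoeff_stieltjes V j) (constantCoeff_stieltjes V' j)
    (k := k) fun i hi => by
      rw [coeff_stieltjes, coeff_stieltjes]
      exact stieltjesMoment_congr i j j fun l hl => h l (by omega)
  have h2 := stieltjesMoment_top k j h
  rw [coeff_stieltjes, coeff_stieltjes] at h1
  rw [voltDensity, voltDensity, Nat.add_sub_cancel, Nat.factorial_succ]
  push_cast
  linear_combination (k ! : R) * h1 + (k ! : R) * (k + 1) * h2

end Densities

end FormalSeries

/-! ### From lattice functions to polynomials in one row; the order of the densities. -/

section Fields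

/-- The restriction of a field to the row with number `n`. -/
def fieldRow (u : LatticeField) (n : ℤ) (j : ℤ) : ℂ := u (n, j)

theorem hasDerivAt_eval_fieldRow (F : MvPolynomial ℤ ℂ) (u : LatticeField) (n j : ℤ) (z : ℂ) :
    HasDerivAt (fun z => MvPolynomial.eval (fieldRow (Function.update u (n, j) z) n) F)
      (MvPolynomial.eval (fieldRow (Function.update u (n, j) z) n) (MvPolynomial.pderiv j F)) z := by
  induction F using MvPolynomial.induction_on with
  | C a => simpa using hasDerivAt_const z a
  | add p q hp hq =>
    simp only [map_add]
    exact hp.add hq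
  | mul_X p i hp =>
    have hX : HasDerivAt (fun z => fieldRow (Function.update u (n, j) z) n i)
        (MvPolynomial.eval (fieldRow (Function.update u (n, j) z) n)
          (MvPolynomial.pderiv j (MvPolynomial.X i))) z := by
      rcases eq_or_ne i j with rfl | h
      · simpa [fieldRow] using hasDerivAt_id' z
      · simpa [fieldRow, h, MvPolynomial.pderiv_X_of_ne h] using hasDerivAt_const z (u (n, i))
    simp only [map_mul, MvPolynomial.eval_X]
    refine (hp.mul hX).congr_deriv ?_
    simp only [map_mul, MvPolynomial.eval_X, Derivation.leibniz, smul_eq_mul, map_add]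
    ring

theorem partialU_eval_fieldRow (c : ℂ) (F : MvPolynomial ℤ ℂ) (n n' j : ℤ) (u : LatticeField) :
    partialU (n', j) (fun u => c * MvPolynomial.eval (fieldRow u n) F) u =
      if n' = n then c * MvPolynomial.eval (fieldRow u n) (MvPolynomial.pderiv j F) else 0 := by
  rw [partialU]
  split_ifs with h
  · subst h
    have := (hasDerivAt_eval_fieldRow F u n' j (u (n', j))).const_mul c
    rw [Function.update_eq_self] at this
    exact this.deriv
  · have : ∀ z, fieldRow (Function.update u (n', j) z) n = fieldRow u n := fun z => by
      ext i
      simp [fieldRow, Ne.symm h]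
    simp [this]

theorem derivation_eq_sum_pderiv (D : Derivation ℂ (MvPolynomial ℤ ℂ) (MvPolynomial ℤ ℂ))
    (F : MvPolynomial ℤ ℂ) :
    D F = ∑ j ∈ F.vars, D (MvPolynomial.X j) * MvPolynomial.pderiv j F := by
  classical
  have hsum : ∀ (s : Finset ℤ) (E : ℤ → Derivation ℂ (MvPolynomial ℤ ℂ) (MvPolynomial ℤ ℂ))
      (G : MvPolynomial ℤ ℂ), (∑ j ∈ s, E j) G = ∑ j ∈ s, E j G := fun s E G => by
    induction s using Finset.induction_on with
    | empty => simp
    | insert a s ha ih => rw [Finset.sum_insert ha, Finset.sum_insert ha, Derivation.add_apply, ih]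
  have h := MvPolynomial.derivation_eq_of_forall_mem_vars (D₁ := D)
    (D₂ := ∑ j ∈ F.vars, D (MvPolynomial.X j) • MvPolynomial.pderiv j) (f := F) fun i hi => by
      have : ∀ j ∈ F.vars, (D (MvPolynomial.X j) • MvPolynomial.pderiv (R := ℂ) j)
          (MvPolynomial.X i) = if j = i then D (MvPolynomial.X i) else 0 := fun j _ => by
        by_cases hj : j = i
        · subst hj
          simp
        · simp [hj, MvPolynomial.pderiv_X_of_ne (Ne.symm hj)]
      rw [hsum, Finset.sum_congr rfl this]
      simp [hi]
  rw [h, hsum]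
  rfl

/-- For polynomial functions of one row, the derivative along a flow is a formal derivation. -/
theorem flowDeriv_eval_fieldRow (V h : LatticeFn) (n m : ℤ) (u : LatticeField) (c a : ℂ)
    (F : MvPolynomial ℤ ℂ) (D : Derivation ℂ (MvPolynomial ℤ ℂ) (MvPolynomial ℤ ℂ))
    (hh : ∀ u, h n m u = c * MvPolynomial.eval (fieldRow u n) F)
    (hV : ∀ j, V n j u = a * MvPolynomial.eval (fieldRow u n) (D (MvPolynomial.X j))) :
    flowDeriv V h n m u = c * a * MvPolynomial.eval (fieldRow u n) (D F) := by
  classical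
  have h1 : h n m = fun u => c * MvPolynomial.eval (fieldRow u n) F := funext hh
  rw [flowDeriv, finsum_eq_sum_of_support_subset (s := F.vars.map ⟨fun j => (n, j), fun _ _ h => by
    simpa using h⟩), Finset.sum_map, derivation_eq_sum_pderiv D F, map_sum, Finset.mul_sum]
  · refine Finset.sum_congr rfl fun j _ => ?_
    change V n j u * partialU (n, j) (h n m) u = _
    rw [h1, partialU_eval_fieldRow, if_pos rfl, hV, map_mul]
    ring
  · rintro ⟨n', j⟩ hs
    simp only [Function.mem_support] at hs
    rw [h1, partialU_eval_fieldRow] at hs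
    have hn : n' = n := by
      by_contra hn
      simp [hn] at hs
    have hj : j ∈ F.vars := by
      by_contra hj
      simp [MvPolynomial.pderiv_eq_zero_of_notMem_vars hj] at hs
    subst hn
    exact Finset.mem_coe.2 (Finset.mem_map.2 ⟨j, hj, rfl⟩)

/-- The derivation `∂u_j = (u_j² - 1)(u_{j+1} - u_{j-1})`. -/
noncomputable def volterraDerivation : Derivation ℂ (MvPolynomial ℤ ℂ) (MvPolynomial ℤ ℂ) :=
  MvPolynomial.mkDerivation ℂ fun j => (MvPolynomial.X j ^ 2 - 1) *
    (MvPolynomial.X (j + 1) - MvPolynomial.X (j - 1))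

/-- The derivation `∂u_j = (u_j² - 1)((j + 1)u_{j+1} - (j - 1)u_{j-1})`. -/
noncomputable def masterDerivation : Derivation ℂ (MvPolynomial ℤ ℂ) (MvPolynomial ℤ ℂ) :=
  MvPolynomial.mkDerivation ℂ fun j => (MvPolynomial.X j ^ 2 - 1) *
    (((j + 1 : ℤ) : MvPolynomial ℤ ℂ) * MvPolynomial.X (j + 1) -
      ((j - 1 : ℤ) : MvPolynomial ℤ ℂ) * MvPolynomial.X (j - 1))

theorem volterraDerivation_X (j : ℤ) : volterraDerivation (MvPolynomial.X j) =
    (MvPolynomial.X j ^ 2 - 1) * (MvPolynomial.X (j + 1) - MvPolynomial.X (j - 1)) :=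
  MvPolynomial.mkDerivation_X _ _ _

theorem masterDerivation_X (j : ℤ) : masterDerivation (MvPolynomial.X j) =
    (MvPolynomial.X j ^ 2 - 1) *
      (((j + 1 : ℤ) : MvPolynomial ℤ ℂ) * MvPolynomial.X (j + 1) -
      ((j - 1 : ℤ) : MvPolynomial ℤ ℂ) * MvPolynomial.X (j - 1)) :=
  MvPolynomial.mkDerivation_X _ _ _

theorem symmF_eq (β τ : ℂ) (n j : ℤ) (u : LatticeField) :
    symmF β τ n j u = coeffA β n τ *
      MvPolynomial.eval (fieldRow u n) (volterraDerivation (MvPolynomial.X j)) := by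
  simp [symmF, volterraDerivation_X, fieldRow]

theorem masterG_eq (β τ : ℂ) (n j : ℤ) (u : LatticeField) :
    masterG β τ n j u = coeffA β n τ *
      MvPolynomial.eval (fieldRow u n) (masterDerivation (MvPolynomial.X j)) := by
  simp [masterG, masterDerivation_X, fieldRow]

theorem eval_voltDensity (u : LatticeField) (n : ℤ) (k : ℕ) (j : ℤ) :
    MvPolynomial.eval (fieldRow u n) (voltDensity (miura MvPolynomial.X) k j) =
      voltDensity (miura (fieldRow u n)) k j := by
  rw [map_voltDensity, map_miura]
  simp

theorem eval_voltFlux (u : LatticeField) (n : ℤ) (k : ℕ) (j : ℤ) :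
    MvPolynomial.eval (fieldRow u n) (voltFlux (miura MvPolynomial.X) k j) =
      voltFlux (miura (fieldRow u n)) k j := by
  rw [map_voltFlux, map_miura]
  simp

theorem map_miuraNeg {R R' : Type*} [CommRing R] [CommRing R'] (ψ : R →+* R') (u : ℤ → R) :
    (fun i => ψ (miuraNeg u i)) = miuraNeg fun i => ψ (u i) := by
  ext i
  simp [miuraNeg]

theorem eval_voltFlux_neg (u : LatticeField) (n : ℤ) (k : ℕ) (j : ℤ) :
    MvPolynomial.eval (fieldRow u n) (voltFlux (miuraNeg MvPolynomial.X) k j) =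
      voltFlux (miuraNeg (fieldRow u n)) k j := by
  rw [map_voltFlux, map_miuraNeg]
  simp

theorem eval_gaugeDensity (u : LatticeField) (n : ℤ) (k : ℕ) (j : ℤ) :
    MvPolynomial.eval (fieldRow u n) (gaugeDensity MvPolynomial.X k j) =
      gaugeDensity (fieldRow u n) k j := by
  rw [map_gaugeDensity]
  simp

/-- The variables of `MvPolynomial (Fin l) ℂ` as a sequence, extended by zero. -/
noncomputable def finVar (l : ℕ) (j : ℤ) : MvPolynomial (Fin l) ℂ :=
  if h : j.toNat < l then MvPolynomial.X ⟨j.toNat, h⟩ else 0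

theorem eval_finVar {l : ℕ} (x : ℤ → ℂ) (i : ℕ) (hi : i < l) :
    MvPolynomial.eval (fun i : Fin l => x (i : ℕ)) (finVar l i) = x i := by
  simp [finVar, hi]

theorem polyFn_voltDensity (c : ℤ → ℂ) {k : ℕ} (hk : 1 ≤ k) (n m : ℤ) (u : LatticeField) :
    polyFn c 0 (voltDensity (miura (finVar (k + 1))) k 0) n m u =
      c n * voltDensity (miura (fieldRow u n)) k m := by
  rw [polyFn, map_voltDensity, map_miura]
  congr 1
  -- Locality of the density ensures that the default values of `finVar` outside 0, …, k are never
  -- read.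
  refine voltDensity_congr hk (miura_congr fun i hi => ?_)
  rw [zero_add, eval_finVar (fun i => u (n, m + 0 + i)) i hi, fieldRow, add_zero]

/-- The flux also involves the site to the left of its anchor; anchoring at 1 and starting at offset
-1 gives u_{m-1} the index 0. -/
theorem polyFn_voltFlux (c : ℤ → ℂ) (k : ℕ) (n m : ℤ) (u : LatticeField) :
    polyFn c (-1) (voltFlux (miura (finVar (k + 2))) k 1) n m u =
      c n * voltFlux (miura (fieldRow u n)) k m := by
  rw [polyFn, map_voltFlux, map_miura]
  congr 1
  refine voltFlux_miura_congr fun i hi => ?_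
  rw [sub_self, zero_add, eval_finVar (fun i => u (n, m + -1 + i)) i hi, fieldRow, sub_eq_add_neg]

theorem polyFn_gaugeDensity (c : ℤ → ℂ) {k : ℕ} (hk : 1 ≤ k) (n m : ℤ) (u : LatticeField) :
    polyFn c 0 (gaugeDensity (finVar k) k 0) n m u =
      c n * gaugeDensity (fieldRow u n) k m := by
  rw [polyFn, map_gaugeDensity]
  refine congrArg (c n * ·) (gaugeDensity_congr (u' := fieldRow u n) (j' := m) hk fun i hi => ?_)
  rw [zero_add, eval_finVar (fun i => u (n, m + 0 + i)) i hi, fieldRow, add_zero]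

theorem prod_miura {R : Type*} [CommRing R] (u : ℤ → R) (k : ℕ) (j : ℤ) :
    ∏ i ∈ Finset.range (k + 1), miura u (j + i) =
      (u j + 1) * (∏ i ∈ Finset.range k, (u (j + 1 + i) ^ 2 - 1)) * (u (j + 1 + k) - 1) := by
  induction k with
  | zero => simp [miura, mul_comm]
  | succ k ih =>
    rw [Finset.prod_range_succ, ih, Finset.prod_range_succ]
    rw [← add_one_add_natCast j k, miura]
    push_cast
    rw [← add_assoc (j + 1)]
    ring

/-- The commutator is a derivation that vanishes on the variables. -/
theorem pderiv_comm (i j : ℤ) (F : MvPolynomial ℤ ℂ) :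
    MvPolynomial.pderiv i (MvPolynomial.pderiv j F) =
      MvPolynomial.pderiv j (MvPolynomial.pderiv i F) := by
  have h : ⁅(MvPolynomial.pderiv i : Derivation ℂ (MvPolynomial ℤ ℂ) (MvPolynomial ℤ ℂ)),
      (MvPolynomial.pderiv j : Derivation ℂ (MvPolynomial ℤ ℂ) (MvPolynomial ℤ ℂ))⁆ = 0 := by
    refine MvPolynomial.derivation_ext fun l => ?_
    rw [Derivation.commutator_apply, Derivation.zero_apply]
    rcases eq_or_ne l i with rfl | hi <;> rcases eq_or_ne l j with rfl | hj <;>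
      simp [*]
  have := congrArg (fun D => D F) h
  simpa [Derivation.commutator_apply, sub_eq_zero] using this

/-- The mixed derivative of the density with respect to its extreme variables. -/
theorem pderiv_pderiv_voltDensity (k : ℕ) (m : ℤ) :
    MvPolynomial.pderiv (m + 1 + k) (MvPolynomial.pderiv m
      (voltDensity (miura (MvPolynomial.X : ℤ → MvPolynomial ℤ ℂ)) (k + 1) m)) =
    ((k + 1).factorial : MvPolynomial ℤ ℂ) *
      ∏ i ∈ Finset.range k, (MvPolynomial.X (m + 1 + i) ^ 2 - 1) := by
  classical
  -- Freezing the last variable at 1 makes the last Miura factor vanish. The density then splits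
  -- into a part free of that variable and the explicit product.
  set w : ℤ → MvPolynomial ℤ ℂ := Function.update MvPolynomial.X (m + 1 + k) 1 with hw
  have h := voltDensity_top (V := miura MvPolynomial.X) (V' := miura w) k m fun i hi =>
    miura_congr (k := k) (fun l hl => by
      rw [hw, Function.update_of_ne (by omega)]) i hi
  have hzero : ∀ j, MvPolynomial.pderiv (m + 1 + k) (miura w j) = 0 := by
    have hX : ∀ j, MvPolynomial.pderiv (m + 1 + k) (w j) = 0 := fun j => by
      rcases eq_or_ne j (m + 1 + k) with rfl | hj
      · simp [hw]
      · rw [hw, Function.update_of_ne hj, MvPolynomial.pderiv_X_of_ne hj]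
    intro j
    simp [miura, Derivation.leibniz, hX]
  have hw1 : w (m + 1 + k) = 1 := by simp [hw]
  rw [prod_miura, prod_miura, hw1, sub_self, mul_zero, mul_zero, sub_zero, sub_eq_iff_eq_add] at h
  have hM : ∀ j, (∀ i : ℕ, i < k → m + 1 + i ≠ j) → MvPolynomial.pderiv j
      (∏ i ∈ Finset.range k, ((MvPolynomial.X (m + 1 + i) : MvPolynomial ℤ ℂ) ^ 2 - 1)) = 0 := by
    intro j hj
    refine Finset.prod_induction _ (fun F => MvPolynomial.pderiv j F = 0) (fun a b ha hb => ?_)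
      (by simp) fun i hi => ?_
    · rw [Derivation.leibniz, ha, hb, smul_zero, smul_zero, add_zero]
    · simp [MvPolynomial.pderiv_X_of_ne (hj i (Finset.mem_range.1 hi))]
  rw [h, map_add, map_add, pderiv_comm _ _ (voltDensity (miura w) (k + 1) m),
    derivation_voltDensity_eq_zero _ _ hzero, map_zero, zero_add, derivation_natCast_mul,
    derivation_natCast_mul]
  simp only [Derivation.leibniz, map_add, map_sub, Derivation.map_one_eq_zero, smul_eq_mul,
    MvPolynomial.pderiv_X_self, hM m fun i _ => by omega, hM (m + 1 + k) fun i _ => by omega,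
    MvPolynomial.pderiv_X_of_ne (show m + 1 + (k : ℤ) ≠ m by omega)]
  simp

theorem hasOrder_voltDensity {c : ℤ → ℂ} (hc : ∀ n, c n ≠ 0) {p : LatticeFn} {k : ℕ} (hk : 1 ≤ k)
    (hp : ∀ n m u, p n m u = c n * voltDensity (miura (fieldRow u n)) k m) : HasOrder p k := by
  obtain ⟨k, rfl⟩ := Nat.exists_eq_add_of_le' hk
  refine ⟨(k + 1 : ℕ), 0, by positivity, by simp, fun n m u w h => ?_, fun n m => ?_⟩
  · rw [hp, hp]
    congr 1
    exact voltDensity_congr hk (miura_congr fun i hi => h i (by positivity) (by omega))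
  · have hp' : p n m = fun u => c n * MvPolynomial.eval (fieldRow u n)
        (voltDensity (miura MvPolynomial.X) (k + 1) m) := by
      ext u
      rw [hp, eval_voltDensity]
    have h1 : partialU (n, m + 0) (p n m) = fun u => c n * MvPolynomial.eval (fieldRow u n)
        (MvPolynomial.pderiv m (voltDensity (miura MvPolynomial.X) (k + 1) m)) := by
      ext u
      rw [add_zero, hp', partialU_eval_fieldRow, if_pos rfl]
    -- Any constant other than ±1 would do: every factor u² - 1 is then nonzero.
    refine ⟨fun _ => 2, ?_⟩
    rw [h1, partialU_eval_fieldRow, if_pos rfl,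
      ← add_one_add_natCast, pderiv_pderiv_voltDensity, map_mul,
      map_prod]
    refine mul_ne_zero (hc n) (mul_ne_zero ?_ (Finset.prod_ne_zero_iff.2 fun i _ => ?_))
    · simpa using Nat.factorial_ne_zero (k + 1)
    · simp only [map_sub, map_pow, MvPolynomial.eval_X, map_one, fieldRow]
      norm_num

end Fields

/-! ### The conservation laws and the master symmetry recursion on the lattice. -/

section Hierarchy

/-- On solutions the scaled Miura variables of consecutive rows are related by a Bäcklund
transformation of the Volterra equation. -/
theorem coeffA_mul_miura {β τ : ℂ} {u : LatticeField} (hu : IsSolutionAt β τ u) (n : ℤ) :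
    (fun j => coeffA β (n + 1) τ * miura (fieldRow u (n + 1)) j) =
      fun j => coeffA β n τ * miuraNeg (fieldRow u n) j :=
  funext fun j => (hu n j).symm

theorem isConservationLaw_voltDensity {β τ : ℂ} {p q : LatticeFn} {k : ℕ} (hk : 1 ≤ k)
    (hp : ∀ n m u, p n m u = coeffA β n τ ^ k * voltDensity (miura (fieldRow u n)) k m)
    (hq : ∀ n m u, q n m u = coeffA β n τ ^ k * gaugeDensity (fieldRow u n) k m) :
    IsConservationLaw (IsSolutionAt β τ) p q := by
  intro u hu n m
  rw [shiftN, shiftM, hp, hp, hq, hq, ← voltDensity_mul _ _ hk, coeffA_mul_miura hu,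
    voltDensity_mul _ _ hk]
  linear_combination coeffA β n τ ^ k * voltDensity_miuraNeg_sub (fieldRow u n) k m

theorem hasDerivAt_coeffA_pow {β τ : ℂ} (hτ : IsRegularTime β τ) (n : ℤ) {k : ℕ} (hk : 1 ≤ k) :
    HasDerivAt (fun t => coeffA β n t ^ k) (-(4 * k * coeffA β n τ ^ (k + 1))) τ := by
  obtain ⟨k, rfl⟩ := Nat.exists_eq_add_of_le' hk
  have h1 : HasDerivAt (fun t : ℂ => β ^ (-n) + 4 * t) 4 τ := by
    simpa using ((hasDerivAt_id' τ).const_mul 4).const_add (β ^ (-n))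
  have h2 : HasDerivAt (fun t => coeffA β n t) (-4 / (β ^ (-n) + 4 * τ) ^ 2) τ := h1.inv (hτ n)
  refine (h2.pow (k + 1)).congr_deriv ?_
  simp only [coeffA, Nat.add_sub_cancel, div_eq_mul_inv, ← inv_pow]
  ring

/-- The term -4k from the explicit τ-dependence is what cancels the 4k terms of
`derivation_voltDensity_master` and `derivation_gaugeDensity_master`. -/
theorem totalDerivTau_eval {β τ : ℂ} (hτ : IsRegularTime β τ) {p : ℂ → LatticeFn} {k : ℕ}
    (hk : 1 ≤ k) (n m : ℤ) (u : LatticeField) (F : MvPolynomial ℤ ℂ)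
    (hp : ∀ t u, p t n m u = coeffA β n t ^ k * MvPolynomial.eval (fieldRow u n) F) :
    totalDerivTau β p τ n m u = coeffA β n τ ^ (k + 1) *
      (MvPolynomial.eval (fieldRow u n) (masterDerivation F) -
        4 * k * MvPolynomial.eval (fieldRow u n) F) := by
  have h1 : (fun t => p t n m u) =
      fun t => coeffA β n t ^ k * MvPolynomial.eval (fieldRow u n) F := funext fun t => hp t u
  rw [totalDerivTau, h1, ((hasDerivAt_coeffA_pow hτ n hk).mul_const _).deriv,
    flowDeriv_eval_fieldRow _ _ n m u _ _ F masterDerivation (hp τ)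
      fun j => masterG_eq β τ n j u]
  ring

theorem isMasterHierarchy_volt {β : ℂ} {p q r : ℕ → ℂ → LatticeFn}
    (hp : ∀ k, 1 ≤ k → ∀ τ n m u,
      p k τ n m u = coeffA β n τ ^ k * voltDensity (miura (fieldRow u n)) k m)
    (hq : ∀ k, 1 ≤ k → ∀ τ n m u,
      q k τ n m u = coeffA β n τ ^ k * gaugeDensity (fieldRow u n) k m)
    (hr : ∀ k τ n m u,
      r k τ n m u = coeffA β n τ ^ (k + 1) * voltFlux (miura (fieldRow u n)) k m) :
    IsMasterHierarchy β p q r where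
  start_p τ n m u := by
    rw [hp 1 le_rfl, voltDensity_one, pow_one]
    rfl
  start_q τ n m u := by
    rw [hq 1 le_rfl, gaugeDensity_one, pow_one, fieldRow]
    ring
  law k hk τ _ := isConservationLaw_voltDensity hk (hp k hk τ) (hq k hk τ)
  flux k hk τ _ n m u := by
    rw [flowDeriv_eval_fieldRow _ _ n m u (coeffA β n τ ^ k) (coeffA β n τ)
      (voltDensity (miura MvPolynomial.X) k m) volterraDerivation
      (fun u => by rw [hp k hk, eval_voltDensity]) fun j => symmF_eq β τ n j u,
      derivation_voltDensity_volterra _ _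
        (derivation_miura_volterra _ _ volterraDerivation_X) hk, shiftM, hr, hr, map_sub,
      eval_voltFlux, eval_voltFlux]
    ring
  step_p k hk τ hτ n m u := by
    rw [totalDerivTau_eval hτ hk n m u (voltDensity (miura MvPolynomial.X) k m)
      (fun t u => by rw [hp k hk, eval_voltDensity]),
      derivation_voltDensity_master _ _ (derivation_miura_master _ _ masterDerivation_X) hk,
      shiftM, hr, hr, hp (k + 1) (by omega)]
    simp only [map_add, map_sub, map_mul, map_intCast, map_natCast, map_one, map_ofNat,
      eval_voltFlux, eval_voltDensity]
    push_cast
    ring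
  step_q k hk τ hτ u hu n m := by
    -- Solutions enter only here: absorbing A_{n+1}^{k+1} into the Miura variables turns r at n + 1
    -- into A_n^{k+1} times the flux of w in row n.
    rw [totalDerivTau_eval hτ hk n m u (gaugeDensity MvPolynomial.X k m)
      (fun t u => by rw [hq k hk, eval_gaugeDensity]),
      derivation_gaugeDensity_master _ _ masterDerivation_X hk,
      shiftN, hr, hr, hq (k + 1) (by omega), ← voltFlux_mul (coeffA β (n + 1) τ),
      coeffA_mul_miura hu, voltFlux_mul]
    simp only [map_add, map_sub, map_mul, map_intCast, map_natCast, map_one, map_ofNat,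
      eval_voltFlux, eval_voltFlux_neg, eval_gaugeDensity]
    ring

theorem coeffA_zero (β : ℂ) (n : ℤ) : coeffA β n 0 = β ^ n := by
  rw [coeffA, mul_zero, add_zero, zpow_neg, inv_inv]

theorem isSolutionAt_zero {β : ℂ} (hβ : β ≠ 0) {u : LatticeField} (hu : IsSolution β u) :
    IsSolutionAt β 0 u := by
  intro n m
  rw [coeffA_zero, coeffA_zero, hu n m, zpow_add_one₀ hβ]
  ring

end Hierarchy

theorem mainTheorem2 :
    ∃ (P : (k : ℕ) → MvPolynomial (Fin (k + 1)) ℂ) (Q : (k : ℕ) → MvPolynomial (Fin k) ℂ)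
      (R : (k : ℕ) → MvPolynomial (Fin (k + 2)) ℂ),
      ∀ β : ℂ, β ≠ 0 →
        (∀ k : ℕ, 1 ≤ k →
          IsConservationLaw (IsSolution β)
            (polyFn (fun n => β ^ (n * (k : ℤ))) 0 (P k))
            (polyFn (fun n => β ^ (n * (k : ℤ))) 0 (Q k)) ∧
          HasOrder (polyFn (fun n => β ^ (n * (k : ℤ))) 0 (P k)) k) ∧
        IsMasterHierarchy β
          (fun k τ => polyFn (fun n => coeffA β n τ ^ k) 0 (P k))
          (fun k τ => polyFn (fun n => coeffA β n τ ^ k) 0 (Q k))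
          (fun k τ => polyFn (fun n => coeffA β n τ ^ (k + 1)) (-1) (R k)) := by
  refine ⟨fun k => voltDensity (miura (finVar (k + 1))) k 0, fun k => gaugeDensity (finVar k) k 0,
    fun k => voltFlux (miura (finVar (k + 2))) k 1, fun β hβ => ⟨fun k hk => ⟨?_, ?_⟩, ?_⟩⟩
  -- The undeformed laws are the case τ = 0, where A_n = β^n.
  · have hc : ∀ n : ℤ, β ^ (n * (k : ℤ)) = coeffA β n 0 ^ k := fun n => by
      rw [coeffA_zero, zpow_mul, zpow_natCast]
    have h := isConservationLaw_voltDensity (β := β) (τ := 0) hk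
      (p := polyFn (fun n => β ^ (n * (k : ℤ))) 0 (voltDensity (miura (finVar (k + 1))) k 0))
      (q := polyFn (fun n => β ^ (n * (k : ℤ))) 0 (gaugeDensity (finVar k) k 0))
      (fun n m u => by rw [polyFn_voltDensity _ hk, hc])
      (fun n m u => by rw [polyFn_gaugeDensity _ hk, hc])
    exact fun u hu => h u (isSolutionAt_zero hβ hu)
  · exact hasOrder_voltDensity (c := fun n => β ^ (n * (k : ℤ))) (fun n => zpow_ne_zero _ hβ) hk
      fun n m u => polyFn_voltDensity _ hk n m u
  · exact isMasterHierarchy_volt (fun k hk τ n m u => polyFn_voltDensity _ hk n m u)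
      (fun k hk τ n m u => polyFn_gaugeDensity _ hk n m u) fun k τ n m u => polyFn_voltFlux _ k n m u
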